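/- A merge tree $(T,f)$ is a finite rooted tree $T$ with a function $f:V(T)\to\mathbb{R}\cup\{\infty\}$ such that adjacent vertices have different values, every non-root vertex has exactly one neighbor of higher value, and the root has degree one and is the only vertex of value $\infty$. Two merge trees are considered to be the same if one is obtained from the other by a finite sequence of vertex renamings, subdivisions of an edge $uv$ with $f(u)<f(v)$ by a new vertex $w$ with $f(u)<f(w)<f(v)$, and inverses of these operations; $\mathsf{MT}$ is the resulting space of (unlabeled, finite) merge trees. Let $|T|$ be the metric tree of $(T,f)$, without its point at infinity: $f$ is extended linearly along the edges, the edge at the root is an infinite ray, and the distance of two points is the length of the path between them, where length is measured by the change of $f$. Write $u\preceq x$ if $x$ is an ancestor of $u$ (or $u=x$), i.e. if $f$ increases along the path from $u$ to $x$, let $\mathrm{LCA}(S)$ be the lowest common ancestor of a finite set $S\subset|T|$, and let $\mathrm{depth}(w)=\sup_{u\preceq w}(f(w)-f(u))$. For $\delta\in\mathbb{R}$, a $\delta$-good map $\alpha:(T,f)\to(T',f')$ is a continuous map $\alpha:|T|\to|T'|$ such that (i) $f'(\alpha(x))-f(x)=\delta$ for all $x\in|T|$; (ii) for every $w\in\mathrm{Im}(\alpha)$,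 with $x'=\mathrm{LCA}(\alpha^{-1}(w))$, one has $f(x')-f(u)\le 2\delta$ for all $u\in\alpha^{-1}(w)$; (iii) $\mathrm{depth}(w)\le 2\delta$ for every $w\in|T'|\setminus\mathrm{Im}(\alpha)$. The interleaving distance is $$d_I((T,f),(T',f'))=\inf\{\delta \mid \text{there is a }\delta\text{-good map }(T,f)\to(T',f')\};$$ it depends only on the classes of the two trees in $\mathsf{MT}$. For a path $\gamma:[0,1]\to\mathsf{MT}$ that is continuous with respect to $d_I$, let $$L_{d_I}(\gamma)=\sup\sum_{i=0}^{n-1}d_I(\gamma(t_i),\gamma(t_{i+1})),$$ the supremum being over all $n$ and all partitions $0=t_0\le t_1\le\dots\le t_n=1$. Let $\hat d_I(T,T')=\inf_\gamma L_{d_I}(\gamma)$, the infimum being over all continuous paths $\gamma$ with $\gamma(0)=T$ and $\gamma(1)=T'$. Theorem. On the space $\mathsf{MT}$ of finite (unlabeled) merge trees, $d_I=\hat d_I$; that is, $d_I(T,T')=\hat d_I(T,T')$ for all $T,T'\in\mathsf{MT}$. -/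

import Mathlib

open scoped ENNReal Topology

/-- A merge tree: a finite tree with a root and a height function `f : V → ℝ ∪ {∞}` such that
adjacent vertices have different heights, every non-root vertex has exactly one higher neighbour,
the root has degree one, and the root is the only vertex of height `∞`. -/
structure MergeTree where
  V : Type
  finite : Finite V
  G : SimpleGraph V
  isTree : G.IsTree
  root : V
  f : V → WithTop ℝ
  f_ne_of_adj : ∀ u v, G.Adj u v → f u ≠ f v
  existsUnique_higher : ∀ v, v ≠ root → ∃! w, G.Adj v w ∧ f v < f w
  root_degree_one : ∃! w, G.Adj root w
  f_eq_top_iff : ∀ v, f v = ⊤ ↔ v = root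

namespace MergeTree

attribute [instance] MergeTree.finite

/-- `T.Up u v`: `v` is the higher endpoint of an edge `uv`. -/
def Up (T : MergeTree) (u v : T.V) : Prop := T.G.Adj u v ∧ T.f u < T.f v

/-- `T.Below u v`: the vertex `v` is an ancestor of `u` (or equal to `u`), i.e. there is a
path from `u` to `v` along which `f` increases. -/
def Below (T : MergeTree) : T.V → T.V → Prop := Relation.ReflTransGen T.Up

theorem up_unique {T : MergeTree} {u v w : T.V} (hv : T.Up u v) (hw : T.Up u w) : v = w := by
  have hu : u ≠ T.root := by
    intro h
    have h2 := hv.2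
    rw [(T.f_eq_top_iff u).2 h] at h2
    exact not_top_lt h2
  exact (T.existsUnique_higher u hu).unique hv hw

theorem Below.f_le {T : MergeTree} {u v : T.V} (h : T.Below u v) : T.f u ≤ T.f v := by
  induction h with
  | refl => exact le_rfl
  | tail _ h ih => exact ih.trans h.2.le

theorem Below.eq_or {T : MergeTree} {u v : T.V} (h : T.Below u v) :
    u = v ∨ ∃ p, T.Up u p ∧ T.Below p v :=
  (Relation.ReflTransGen.cases_head h).imp id id

theorem Below.antisymm {T : MergeTree} {u v : T.V} (h : T.Below u v) (h' : T.f v ≤ T.f u) :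
    u = v := by
  rcases h.eq_or with h | ⟨p, hp, hpv⟩
  · exact h
  · exact absurd (hp.2.trans_le (hpv.f_le.trans h')) (lt_irrefl _)

theorem Below.total {T : MergeTree} {u v w : T.V} (hv : T.Below u v) (hw : T.Below u w) :
    T.Below v w ∨ T.Below w v :=
  Relation.ReflTransGen.total_of_right_unique (fun _ _ _ h h' => up_unique h h') hv hw

/-- Points of the metric tree `|T|`, at finite height.  Such a point lies on a unique half-open edge
`[u, v)` where `v` is the higher neighbour of `u`, and is recorded by its lower endpoint
`base = u` and its height, with `f u ≤ height < f v`.  The edge at the root is an infinite ray. -/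
@[ext]
structure Point (T : MergeTree) where
  base : T.V
  height : ℝ
  f_le : T.f base ≤ height
  lt_f : ∀ v, T.Up base v → (height : WithTop ℝ) < T.f v

/-- The ancestor order on `|T|`: `x ≤ y` iff the path from `x` to `y` is increasing in height. -/
instance (T : MergeTree) : PartialOrder T.Point where
  le x y := x.height ≤ y.height ∧ T.Below x.base y.base
  le_refl x := ⟨le_rfl, Relation.ReflTransGen.refl⟩
  le_trans x y z h h' := ⟨h.1.trans h'.1, Relation.ReflTransGen.trans h.2 h'.2⟩
  le_antisymm x y h h' :=
    Point.ext (h.2.antisymm h'.2.f_le) (le_antisymm h.1 h'.1)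

theorem Point.le_def {T : MergeTree} {x y : T.Point} :
    x ≤ y ↔ x.height ≤ y.height ∧ T.Below x.base y.base := Iff.rfl

theorem Point.lt_of_below_up {T : MergeTree} (x : T.Point) {c v : T.V} (h : T.Below x.base c)
    (hv : T.Up c v) : (x.height : WithTop ℝ) < T.f v := by
  rcases h.eq_or with h | ⟨p, hp, hpc⟩
  · exact x.lt_f v (h ▸ hv)
  · exact (x.lt_f p hp).trans_le (hpc.f_le.trans hv.2.le)

theorem Point.base_ne_root {T : MergeTree} (x : T.Point) : x.base ≠ T.root := by
  intro h
  have h2 := x.f_le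
  rw [(T.f_eq_top_iff _).2 h] at h2
  exact absurd h2 (not_le.2 (WithTop.coe_lt_top _))

/-- Two ancestors of the same point are comparable. -/
theorem Point.total_of_le {T : MergeTree} {x y z : T.Point} (hy : x ≤ y) (hz : x ≤ z) :
    y ≤ z ∨ z ≤ y := by
  have key : ∀ y z : T.Point, T.Below y.base z.base → y ≤ z ∨ z ≤ y := by
    intro y z h
    rcases h.eq_or with h' | ⟨p, hp, hpz⟩
    · rcases le_total y.height z.height with h1 | h1
      · exact Or.inl ⟨h1, h⟩
      · exact Or.inr ⟨h1, h' ▸ Relation.ReflTransGen.refl⟩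
    · refine Or.inl ⟨?_, h⟩
      exact WithTop.coe_le_coe.1 ((y.lt_f p hp).le.trans (hpz.f_le.trans z.f_le))
  rcases hy.2.total hz.2 with h | h
  · exact key y z h
  · exact (key z y h).symm

theorem exists_top_vertex (T : MergeTree) :
    ∃ r, r ≠ T.root ∧ ∀ v, v ≠ T.root → T.Below v r := by
  obtain ⟨r, hr, hru⟩ := T.root_degree_one
  refine ⟨r, fun h => T.G.loopless.irrefl _ (h ▸ hr), ?_⟩
  have wf : WellFounded (fun a b : T.V => T.f b < T.f a) :=
    @Finite.wellFounded_of_trans_of_irrefl _ _ _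
      ⟨fun _ _ _ h h' => lt_trans h' h⟩ ⟨fun _ h => lt_irrefl _ h⟩
  intro v
  induction v using wf.induction with
  | _ v ih =>
    intro hv
    obtain ⟨p, hp, -⟩ := T.existsUnique_higher v hv
    by_cases h : p = T.root
    · subst h
      rw [hru v hp.1.symm]
      exact Relation.ReflTransGen.refl
    · exact Relation.ReflTransGen.head hp (ih p hp.2 h)

/-- Any two points of `|T|` have a lowest common ancestor. -/
theorem exists_isLUB_pair {T : MergeTree} (x y : T.Point) : ∃ z, IsLUB {x, y} z := by
  obtain ⟨r, hr, hrv⟩ := T.exists_top_vertex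
  let S : Set T.V := {c | c ≠ T.root ∧ T.Below x.base c ∧ T.Below y.base c}
  have hS : S.Nonempty := ⟨r, hr, hrv _ x.base_ne_root, hrv _ y.base_ne_root⟩
  obtain ⟨c, ⟨hc, hxc, hyc⟩, hmin⟩ := S.exists_min_image T.f S.toFinite hS
  have hne : T.f c ≠ ⊤ := fun h => hc ((T.f_eq_top_iff c).1 h)
  obtain ⟨t, ht⟩ := WithTop.ne_top_iff_exists.1 hne
  refine ⟨⟨c, max t (max x.height y.height), ?_, ?_⟩, ?_, ?_⟩
  · rw [← ht]
    exact WithTop.coe_le_coe.2 (le_max_left _ _)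
  · intro v hv
    have h1 := x.lt_of_below_up hxc hv
    have h2 := y.lt_of_below_up hyc hv
    have h3 := hv.2
    rw [← ht] at h3
    rcases max_choice t (max x.height y.height) with h | h <;> rw [h]
    · exact h3
    · rcases max_choice x.height y.height with h | h <;> rw [h]
      · exact h1
      · exact h2
  · intro z hz
    rcases hz with rfl | rfl
    · exact ⟨(le_max_left _ _).trans (le_max_right _ _), hxc⟩
    · exact ⟨(le_max_right _ _).trans (le_max_right _ _), hyc⟩
  · intro z hz
    have hx : x ≤ z := hz (Set.mem_insert _ _)
    have hy : y ≤ z := hz (Set.mem_insert_of_mem _ rfl)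
    have hcz : T.f c ≤ T.f z.base := hmin z.base ⟨z.base_ne_root, hx.2, hy.2⟩
    refine ⟨max_le ?_ (max_le hx.1 hy.1), ?_⟩
    · apply WithTop.coe_le_coe.1
      rw [ht]
      exact hcz.trans z.f_le
    · rcases hxc.total hx.2 with h | h
      · exact h
      · show T.Below c z.base
        rw [h.antisymm hcz]
        exact Relation.ReflTransGen.refl

/-- `x ⊔ y` is the lowest common ancestor `LCA(x, y)` of two points of `|T|`. -/
noncomputable instance (T : MergeTree) : SemilatticeSup T.Point where
  sup x y := (exists_isLUB_pair x y).choose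
  le_sup_left x y := (exists_isLUB_pair x y).choose_spec.1 (Set.mem_insert _ _)
  le_sup_right x y := (exists_isLUB_pair x y).choose_spec.1 (Set.mem_insert_of_mem _ rfl)
  sup_le x y z hx hy := (exists_isLUB_pair x y).choose_spec.2 (by
    rintro w (rfl | rfl)
    · exact hx
    · exact hy)

theorem Point.eq_of_le_of_height_le {T : MergeTree} {x y : T.Point} (h : x ≤ y)
    (h' : y.height ≤ x.height) : x = y := by
  rcases h.2.eq_or with hb | ⟨p, hp, hpy⟩
  · exact Point.ext hb (le_antisymm h.1 h')
  · have h1 := (x.lt_f p hp).trans_le (hpy.f_le.trans y.f_le)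
    exact absurd (WithTop.coe_lt_coe.1 h1) (not_lt.2 h')

/-- The metric tree `|T|`: the path from `x` to `y` goes up to `LCA(x, y)` and down again, so its
length, with edges `uv` of length `|f u - f v|`, is
`(f (LCA(x, y)) - f x) + (f (LCA(x, y)) - f y)`. -/
noncomputable instance (T : MergeTree) : MetricSpace T.Point where
  dist x y := ((x ⊔ y).height - x.height) + ((x ⊔ y).height - y.height)
  dist_self x := by simp
  dist_comm x y := by rw [sup_comm, add_comm]
  dist_triangle x y z := by
    have hle : x ⊔ z ≤ (x ⊔ y) ⊔ (y ⊔ z) :=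
      sup_le (le_sup_left.trans le_sup_left) (le_sup_right.trans le_sup_right)
    have h1 : y.height ≤ (x ⊔ y).height := (le_sup_right : y ≤ x ⊔ y).1
    have h2 : y.height ≤ (y ⊔ z).height := (le_sup_left : y ≤ y ⊔ z).1
    rcases Point.total_of_le (le_sup_right : y ≤ x ⊔ y) (le_sup_left : y ≤ y ⊔ z) with h | h
    · rw [sup_eq_right.2 h] at hle
      have := hle.1
      linarith
    · rw [sup_eq_left.2 h] at hle
      have := hle.1
      linarith
  eq_of_dist_eq_zero {x y} h := by
    have h1 : x.height ≤ (x ⊔ y).height := (le_sup_left : x ≤ x ⊔ y).1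
    have h2 : y.height ≤ (x ⊔ y).height := (le_sup_right : y ≤ x ⊔ y).1
    have h3 : ((x ⊔ y).height - x.height) + ((x ⊔ y).height - y.height) = 0 := h
    rw [Point.eq_of_le_of_height_le (le_sup_left : x ≤ x ⊔ y) (by linarith)]
    exact (Point.eq_of_le_of_height_le (le_sup_right : y ≤ x ⊔ y) (by linarith)).symm

theorem Point.dist_def {T : MergeTree} (x y : T.Point) :
    dist x y = ((x ⊔ y).height - x.height) + ((x ⊔ y).height - y.height) := rfl

/-- The depth of a point: the largest height difference between it and a point below it. -/
noncomputable def Point.depth {T : MergeTree} (w : T.Point) : ℝ :=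
  sSup ((fun u : T.Point => w.height - u.height) '' Set.Iic w)

/-- The set of height differences defining the depth is bounded, so that `depth` is a true
supremum. -/
theorem Point.depth_bddAbove {T : MergeTree} (w : T.Point) :
    BddAbove ((fun u : T.Point => w.height - u.height) '' Set.Iic w) := by
  have : Nonempty T.V := ⟨T.root⟩
  obtain ⟨c, hc⟩ := Finite.exists_min T.f
  have hw : T.f c ≤ w.height := (hc w.base).trans w.f_le
  obtain ⟨t, ht⟩ := WithTop.ne_top_iff_exists.1 (ne_top_of_le_ne_top WithTop.coe_ne_top hw)
  refine ⟨w.height - t, ?_⟩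
  rintro _ ⟨u, -, rfl⟩
  have hu : T.f c ≤ u.height := (hc u.base).trans u.f_le
  rw [← ht] at hu
  have := WithTop.coe_le_coe.1 hu
  show w.height - u.height ≤ w.height - t
  linarith

/-- A `δ`-good map `α : |T| → |T'|`. -/
structure IsGood {T T' : MergeTree} (δ : ℝ) (α : T.Point → T'.Point) : Prop where
  continuous : Continuous α
  shift : ∀ x, (α x).height - x.height = δ
  /-- `x'` is the lowest common ancestor of the fibre of `α` over `w`. -/
  fibre : ∀ w ∈ Set.range α, ∃ x', IsLUB (α ⁻¹' {w}) x' ∧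
    ∀ u ∈ α ⁻¹' {w}, x'.height - u.height ≤ 2 * δ
  depth_le : ∀ w ∉ Set.range α, w.depth ≤ 2 * δ

/-- The interleaving distance: the infimum of all `δ` such that there is a `δ`-good map. -/
noncomputable def interleavingDist (T T' : MergeTree) : ℝ≥0∞ :=
  ⨅ (δ : ℝ) (_ : ∃ α : T.Point → T'.Point, IsGood δ α), ENNReal.ofReal δ

/-- `T'` is obtained from `T` by renaming the vertices. -/
def Renaming (T T' : MergeTree) : Prop :=
  ∃ e : T.G ≃g T'.G, ∀ v, T'.f (e v) = T.f v

/-- `T'` is obtained from `T` by subdividing an edge `uv`, with `f u < f v`, by one new vertex `w`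
with `f u < f w < f v`.  The map `i` includes the old vertices into the new ones. -/
def Subdivision (T T' : MergeTree) : Prop :=
  ∃ (i : T.V → T'.V) (u v : T.V) (w : T'.V),
    Function.Injective i ∧ (∀ b, b ≠ w ↔ b ∈ Set.range i) ∧ (∀ a, T'.f (i a) = T.f a) ∧
    T.G.Adj u v ∧ T.f u < T'.f w ∧ T'.f w < T.f v ∧
    (∀ a, T'.G.Adj (i a) w ↔ a = u ∨ a = v) ∧
    ∀ a b, T'.G.Adj (i a) (i b) ↔
      T.G.Adj a b ∧ ¬ (a = u ∧ b = v) ∧ ¬ (a = v ∧ b = u)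

/-- Two merge trees are considered to be the same if one can be obtained from the other by a
sequence of subdivisions and inverse subdivisions (and renamings of vertices). -/
def same : Setoid MergeTree :=
  Relation.EqvGen.setoid fun T T' => Renaming T T' ∨ Subdivision T T'

/-- Height-preserving order isomorphism of the metric trees (auxiliary). -/
def RealIso (T T' : MergeTree) : Prop :=
  ∃ e : T.Point ≃o T'.Point, ∀ x, (e x).height = x.height

theorem RealIso.symm {T T' : MergeTree} : RealIso T T' → RealIso T' T
  | ⟨e, he⟩ => ⟨e.symm, fun x => by rw [← he, e.apply_symm_apply]⟩

theorem RealIso.of_map {T T' : MergeTree} (φ : T.Point → T'.Point)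
    (hh : ∀ x, (φ x).height = x.height) (hle : ∀ x y, φ x ≤ φ y ↔ x ≤ y)
    (hs : Function.Surjective φ) : RealIso T T' :=
  ⟨RelIso.ofSurjective (OrderEmbedding.ofMapLEIff φ hle) hs, hh⟩

theorem Renaming.realIso {T T' : MergeTree} : Renaming T T' → RealIso T T' := by
  rintro ⟨e, he⟩
  have hup : ∀ a b, T'.Up (e a) (e b) ↔ T.Up a b := by
    intro a b
    simp only [Up, he, SimpleGraph.Iso.map_adj_iff]
  have hbel : ∀ a b, T.Below a b → T'.Below (e a) (e b) := by
    intro a b h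
    exact Relation.ReflTransGen.lift e (fun a b h => (hup a b).2 h) _ _ h
  have hbel' : ∀ a b, T'.Below a b → T.Below (e.symm a) (e.symm b) := by
    intro a b h
    refine Relation.ReflTransGen.lift e.symm (fun a b h => (hup _ _).1 ?_) _ _ h
    simpa using h
  refine RealIso.of_map (fun x => ⟨e x.base, x.height, by rw [he]; exact x.f_le, ?_⟩)
    (fun _ => rfl) ?_ ?_
  · intro v hv
    have h1 : T.Up x.base (e.symm v) := (hup _ _).1 (by simpa using hv)
    have h2 := x.lt_f _ h1
    rw [← he] at h2
    simpa using h2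
  · intro x y
    simp only [Point.le_def]
    refine and_congr_right fun _ => ⟨fun h => ?_, hbel _ _⟩
    simpa using hbel' _ _ h
  · intro y
    refine ⟨⟨e.symm y.base, y.height, ?_, ?_⟩, ?_⟩
    · rw [← he]; simpa using y.f_le
    · intro v hv
      rw [← he]
      exact y.lt_f _ (by simpa using (hup _ _).2 hv)
    · exact Point.ext (by simp) rfl

theorem Subdivision.realIso {T T' : MergeTree} : Subdivision T T' → RealIso T' T := by
  rintro ⟨i, u, v, w, hinj, hrange, hf, huv, huw, hwv, hadjw, hadj⟩
  have hiw : ∀ a, i a ≠ w := fun a => (hrange _).2 ⟨a, rfl⟩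
  have hUuv : T.Up u v := ⟨huv, huw.trans hwv⟩
  have hUuw : T'.Up (i u) w := ⟨(hadjw u).2 (Or.inl rfl), by rw [hf]; exact huw⟩
  have hUwv : T'.Up w (i v) := ⟨((hadjw v).2 (Or.inr rfl)).symm, by rw [hf]; exact hwv⟩
  -- upward edges which are not subdivided
  have hup : ∀ a b, T.Up a b → a ≠ u → T'.Up (i a) (i b) := by
    intro a b h ha
    refine ⟨(hadj a b).2 ⟨h.1, fun h' => ha h'.1, ?_⟩, by rw [hf, hf]; exact h.2⟩
    rintro ⟨rfl, rfl⟩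
    exact lt_asymm h.2 hUuv.2
  have hbel : ∀ a b, T.Below a b → T'.Below (i a) (i b) := by
    intro a b h
    induction h with
    | refl => exact Relation.ReflTransGen.refl
    | @tail b c _ hbc ih =>
      by_cases hb : b = u
      · subst hb
        rw [up_unique hbc hUuv]
        exact (Relation.ReflTransGen.tail ih hUuw).tail hUwv
      · exact Relation.ReflTransGen.tail ih (hup b c hbc hb)
  -- the retraction sending the new vertex to the lower endpoint
  have hcases : ∀ b : T'.V, b = w ∨ ∃ a, i a = b := fun b =>
    (em (b = w)).imp id (fun h => (hrange b).1 h)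
  obtain ⟨r, hri, hrw⟩ : ∃ r : T'.V → T.V, (∀ a, r (i a) = a) ∧ r w = u := by
    classical
    refine ⟨fun b => if h : ∃ a, i a = b then h.choose else u, fun a => ?_, ?_⟩
    · have h : ∃ a', i a' = i a := ⟨a, rfl⟩
      simp only [dif_pos h]
      exact hinj h.choose_spec
    · have h : ¬ ∃ a, i a = w := fun ⟨a, ha⟩ => hiw a ha
      simp only [dif_neg h]
  have hrup : ∀ a b, T'.Up a b → T.Below (r a) (r b) := by
    intro a b h
    rcases hcases a with rfl | ⟨a, rfl⟩
    · rw [up_unique h hUwv, hrw, hri]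
      exact Relation.ReflTransGen.single hUuv
    · by_cases ha : a = u
      · subst ha
        rw [up_unique h hUuw, hrw, hri]
        exact Relation.ReflTransGen.refl
      · rcases hcases b with rfl | ⟨b, rfl⟩
        · rcases (hadjw a).1 h.1 with h' | h'
          · exact absurd h' ha
          · subst h'
            exact absurd h.2 (lt_asymm hUwv.2)
        · rw [hri, hri]
          refine Relation.ReflTransGen.single ⟨((hadj a b).1 h.1).1, ?_⟩
          have := h.2
          rwa [hf, hf] at this
  have hrbel : ∀ a b, T'.Below a b → T.Below (r a) (r b) := by
    intro a b h
    induction h with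
    | refl => exact Relation.ReflTransGen.refl
    | tail _ hbc ih => exact Relation.ReflTransGen.trans ih (hrup _ _ hbc)
  refine RealIso.of_map (fun x => ⟨r x.base, x.height, ?_, ?_⟩) (fun _ => rfl) ?_ ?_
  · rcases hcases x.base with h | ⟨a, h⟩
    · rw [h, hrw]
      exact huw.le.trans (h ▸ x.f_le)
    · rw [← h, hri, ← hf, h]
      exact x.f_le
  · intro p hp
    rcases hcases x.base with h | ⟨a, h⟩
    · rw [h, hrw] at hp
      rw [up_unique hp hUuv, ← hf]
      exact x.lt_f _ (by rw [h]; exact hUwv)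
    · rw [← h, hri] at hp
      by_cases ha : a = u
      · subst ha
        rw [up_unique hp hUuv]
        exact (x.lt_f w (by rw [← h]; exact hUuw)).trans hwv
      · rw [← hf]
        exact x.lt_f _ (by rw [← h]; exact hup _ _ hp ha)
  · intro x y
    simp only [Point.le_def]
    refine and_congr_right fun hxy => ⟨fun h => ?_, hrbel _ _⟩
    rcases hcases x.base with hx | ⟨a, hx⟩ <;> rcases hcases y.base with hy | ⟨b, hy⟩
    · rw [hx, hy]; exact Relation.ReflTransGen.refl
    · rw [hx, ← hy, hrw, hri] at h
      rw [hx, ← hy]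
      rcases h.eq_or with h | ⟨p, hp, hpb⟩
      · exfalso
        have h1 : T'.f w ≤ x.height := hx ▸ x.f_le
        have h2 : (y.height : WithTop ℝ) < T'.f w := y.lt_f w (by rw [← hy, ← h]; exact hUuw)
        exact absurd (WithTop.coe_lt_coe.1 (h2.trans_le h1)) (not_lt.2 hxy)
      · rw [up_unique hp hUuv] at hpb
        exact Relation.ReflTransGen.head hUwv (hbel _ _ hpb)
    · rw [← hx, hy, hrw, hri] at h
      rw [← hx, hy]
      exact Relation.ReflTransGen.tail (hbel _ _ h) hUuw
    · rw [← hx, ← hy, hri, hri] at h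
      rw [← hx, ← hy]
      exact hbel _ _ h
  · intro y
    by_cases hy : y.base = u ∧ T'.f w ≤ y.height
    · refine ⟨⟨w, y.height, hy.2, ?_⟩, Point.ext ?_ rfl⟩
      · intro p hp
        rw [up_unique hp hUwv, hf]
        exact y.lt_f _ (by rw [hy.1]; exact hUuv)
      · simp only [hrw, hy.1]
    · refine ⟨⟨i y.base, y.height, by rw [hf]; exact y.f_le, ?_⟩, Point.ext ?_ rfl⟩
      · intro p hp
        by_cases hu : y.base = u
        · rw [hu] at hp
          rw [up_unique hp hUuw]
          exact not_le.1 fun h => hy ⟨hu, h⟩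
        · obtain ⟨q, hq, -⟩ := T.existsUnique_higher y.base y.base_ne_root
          rw [up_unique hp (hup _ _ hq hu), hf]
          exact y.lt_f _ hq
      · simp only [hri]

theorem IsGood.transport {T T' S S' : MergeTree} {δ : ℝ} {α : T.Point → T'.Point}
    (h : IsGood δ α) (e : S.Point ≃o T.Point) (he : ∀ x, (e x).height = x.height)
    (e' : T'.Point ≃o S'.Point) (he' : ∀ x, (e' x).height = x.height) :
    IsGood δ (fun x => e' (α (e x))) := by
  have iso : ∀ {A B : MergeTree} (g : A.Point ≃o B.Point), (∀ x, (g x).height = x.height) →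
      Isometry g := by
    intro A B g hg
    refine Isometry.of_dist_eq fun x y => ?_
    rw [Point.dist_def, Point.dist_def, ← g.map_sup, hg, hg, hg]
  have hpre : ∀ w, (fun x => e' (α (e x))) ⁻¹' {w} = e ⁻¹' (α ⁻¹' {e'.symm w}) := by
    intro w
    ext x
    simp only [Set.mem_preimage, Set.mem_singleton_iff]
    exact e'.toEquiv.eq_symm_apply.symm
  have hran : ∀ w, w ∈ Set.range (fun x => e' (α (e x))) ↔ e'.symm w ∈ Set.range α := by
    intro w
    constructor
    · rintro ⟨x, rfl⟩
      exact ⟨e x, by simp⟩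
    · rintro ⟨x, hx⟩
      exact ⟨e.symm x, by simp [hx]⟩
  refine ⟨(iso e' he').continuous.comp (h.continuous.comp (iso e he).continuous), ?_, ?_, ?_⟩
  · intro x
    have := h.shift (e x)
    rw [he] at this
    simpa [he'] using this
  · intro w hw
    obtain ⟨x', hx', hb⟩ := h.fibre _ ((hran w).1 hw)
    rw [hpre]
    refine ⟨e.symm x', ?_, ?_⟩
    · rw [e.isLUB_preimage]
      simpa using hx'
    · intro u hu
      have h1 := hb (e u) hu
      rw [he] at h1
      rwa [← he (e.symm x'), e.apply_symm_apply]
  · intro w hw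
    have h1 := h.depth_le (e'.symm w) (fun hh => hw ((hran w).2 hh))
    have hs : ∀ x, (e'.symm x).height = x.height := fun x => by
      rw [← he', e'.apply_symm_apply]
    refine le_trans (le_of_eq ?_) h1
    unfold Point.depth
    congr 1
    ext t
    constructor
    · rintro ⟨x, hx, rfl⟩
      exact ⟨e'.symm x, e'.symm.le_iff_le.2 hx, by simp only [hs]⟩
    · rintro ⟨x, hx, rfl⟩
      refine ⟨e' x, ?_, by simp only [hs, he']⟩
      have := e'.le_iff_le.2 (Set.mem_Iic.1 hx)
      rwa [e'.apply_symm_apply] at this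

theorem interleavingDist_congr {T T' S S' : MergeTree} (h : RealIso T S) (h' : RealIso T' S') :
    interleavingDist T T' = interleavingDist S S' := by
  have key : ∀ {T T' S S' : MergeTree}, RealIso T S → RealIso T' S' →
      interleavingDist S S' ≤ interleavingDist T T' := by
    intro T T' S S' h h'
    obtain ⟨e, he⟩ := h.symm
    obtain ⟨e', he'⟩ := h'
    refine le_iInf₂ fun δ hδ => ?_
    obtain ⟨α, hα⟩ := hδ
    exact iInf₂_le δ ⟨_, hα.transport e he e' he'⟩
  exact le_antisymm (key h.symm h'.symm) (key h h')

theorem realIso_of_same {T T' : MergeTree} (h : same T T') : RealIso T T' := by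
  have h' : Relation.EqvGen (fun T T' => Renaming T T' ∨ Subdivision T T') T T' := h
  clear h
  induction h' with
  | rel T T' h =>
    rcases h with h | h
    · exact h.realIso
    · exact h.realIso.symm
  | refl T => exact ⟨OrderIso.refl _, fun _ => rfl⟩
  | symm T T' _ ih => exact ih.symm
  | trans T T' T'' _ _ ih ih' =>
    obtain ⟨e, he⟩ := ih
    obtain ⟨e', he'⟩ := ih'
    exact ⟨e.trans e', fun x => by simp [he, he']⟩

end MergeTree

/-- The space `MT` of finite (unlabeled) merge trees, up to subdivision. -/
def MTSpace : Type 1 := Quotient MergeTree.same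

/-- The interleaving distance `d_I` on the space of merge trees. -/
noncomputable def MTSpace.dI : MTSpace → MTSpace → ℝ≥0∞ :=
  Quotient.lift₂ MergeTree.interleavingDist fun _ _ _ _ h h' =>
    MergeTree.interleavingDist_congr (MergeTree.realIso_of_same h) (MergeTree.realIso_of_same h')

/-- A path `γ : [0,1] → X` is continuous with respect to the distance `d`. -/
def ContinuousPath {X : Type*} (d : X → X → ℝ≥0∞) (γ : unitInterval → X) : Prop :=
  ∀ t, Filter.Tendsto (fun s => d (γ t) (γ s)) (𝓝 t) (𝓝 0)

/-- The length of `γ` induced by `d`: the supremum of `∑ i < n, d (γ tᵢ) (γ tᵢ₊₁)` over all `n`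
and all partitions `0 = t₀ ≤ t₁ ≤ ⋯ ≤ tₙ = 1`. -/
noncomputable def pathLength {X : Type*} (d : X → X → ℝ≥0∞) (γ : unitInterval → X) : ℝ≥0∞ :=
  ⨆ (n : ℕ) (t : ℕ → unitInterval) (_ : Monotone t ∧ t 0 = 0 ∧ t n = 1),
    ∑ i ∈ Finset.range n, d (γ (t i)) (γ (t (i + 1)))

/-- The intrinsic metric induced by `d`: the infimum of the lengths of the continuous paths
from `x` to `y`. -/
noncomputable def intrinsicDist {X : Type*} (d : X → X → ℝ≥0∞) (x y : X) : ℝ≥0∞ :=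
  ⨅ (γ : unitInterval → X) (_ : ContinuousPath d γ ∧ γ 0 = x ∧ γ 1 = y), pathLength d γ

namespace MergeTree

/-! The partition `0, 1` already bounds the length of a path below by the distance of its ends, so
only `intrinsicDist ≤ dI` needs work: a δ-good map must yield a path of length at most δ.

Merge trees are turned into matrices. A finite family of points with a member below every point of
the tree (`IsLabelling`) has the matrix of heights of pairwise lowest common ancestors. Such a
matrix is symmetric and satisfies the strong triangle inequality (`IsLabelling.isUltraMatrix`), and
every matrix of this kind comes from a merge tree (`isLabelling_mergePoint`). A δ-good map gives
labellings of both trees by one finite set whose matrices differ by at most δ in each entry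
(`IsGood.exists_isLabelling`); conversely, ε-close matrices give an ε-good map
(`IsLabelling.exists_isGood`).

The two matrices are joined by a line segment. An interpolated matrix may violate the strong
triangle inequality; `ultraClosure` repairs this, is 1-Lipschitz in the sup norm
(`abs_ultraClosure_sub_le`) and fixes both ends. The resulting trees satisfy `d (γ s) (γ t) ≤ |s -
t| * δ`, so they form a continuous path of length at most δ. -/

theorem exists_up (T : MergeTree) {v : T.V} (hv : v ≠ T.root) : ∃ w, T.Up v w :=
  (T.existsUnique_higher v hv).exists

/-! ### Ancestors and topology of the metric tree -/

namespace Point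

variable {T : MergeTree}

theorem le_of_le_of_height_le {x y z : T.Point} (hy : x ≤ y) (hz : x ≤ z)
    (h : y.height ≤ z.height) : y ≤ z :=
  (total_of_le hy hz).elim id fun h' => (eq_of_le_of_height_le h' h).ge

theorem eq_of_le_of_height_eq {x y z : T.Point} (hy : x ≤ y) (hz : x ≤ z)
    (h : y.height = z.height) : y = z :=
  eq_of_le_of_height_le (le_of_le_of_height_le hy hz h.le) h.ge

theorem height_mono {x y : T.Point} (h : x ≤ y) : x.height ≤ y.height := h.1

/-- A point has an ancestor at every larger height. -/
theorem exists_ancestor (x : T.Point) {t : ℝ} (h : x.height ≤ t) :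
    ∃ y, x ≤ y ∧ y.height = t := by
  let S : Set T.V := {c | T.Below x.base c ∧ T.f c ≤ t}
  have hS : S.Nonempty :=
    ⟨x.base, Relation.ReflTransGen.refl, x.f_le.trans (WithTop.coe_le_coe.2 h)⟩
  obtain ⟨c, ⟨hc, hct⟩, hmax⟩ := S.exists_max_image T.f S.toFinite hS
  refine ⟨⟨c, t, hct, fun v hv => ?_⟩, ⟨h, hc⟩, rfl⟩
  by_contra! hvt
  exact absurd hv.2 (hmax v ⟨hc.tail hv, hvt⟩).not_gt

/-- The point of `|T|` at a vertex other than the root. -/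
def ofVertex (v : T.V) (hv : v ≠ T.root) : T.Point where
  base := v
  height := (T.f v).untop fun h => hv ((T.f_eq_top_iff v).1 h)
  f_le := by simp
  lt_f w hw := by simpa using hw.2

@[simp]
theorem coe_height_ofVertex (v : T.V) (hv : v ≠ T.root) :
    ((ofVertex v hv).height : WithTop ℝ) = T.f v :=
  WithTop.coe_untop _ _

theorem ofVertex_base_le (x : T.Point) : ofVertex x.base x.base_ne_root ≤ x :=
  ⟨WithTop.coe_le_coe.1 (by simpa using x.f_le), Relation.ReflTransGen.refl⟩

instance : Nonempty T.Point :=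
  let ⟨r, hr, _⟩ := T.exists_top_vertex
  ⟨ofVertex r hr⟩

/-- Near `z`, all points which are not lower than `z` are ancestors of `z`. -/
theorem exists_forall_le_of_dist_lt (z : T.Point) :
    ∃ r > 0, ∀ y : T.Point, dist z y < r → z.height ≤ y.height → z ≤ y := by
  obtain ⟨v, hv⟩ := T.exists_up z.base_ne_root
  -- The radius is the room left above `z` on its edge, or anything positive on the infinite ray.
  -- Within it the lowest common ancestor of `z` and `y` stays on the edge of `z`.
  obtain ⟨r, hr, hrv⟩ : ∃ r > 0, ((z.height + r : ℝ) : WithTop ℝ) ≤ T.f v := by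
    have hlt := z.lt_f v hv
    induction h : T.f v using WithTop.recTopCoe with
    | top => exact ⟨1, one_pos, le_top⟩
    | coe t =>
      rw [h] at hlt
      exact ⟨t - z.height, sub_pos.2 (WithTop.coe_lt_coe.1 hlt), WithTop.coe_le_coe.2 (by linarith)⟩
  refine ⟨r, hr, fun y hy hzy => ?_⟩
  have hlt : (z ⊔ y).height < z.height + r := by
    have := height_mono (le_sup_right : y ≤ z ⊔ y)
    rw [dist_def] at hy
    linarith
  have hbase : z.base = (z ⊔ y).base := by
    rcases (le_sup_left : z ≤ z ⊔ y).2.eq_or with h | ⟨p, hp, hpb⟩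
    · exact h
    · rw [up_unique hp hv] at hpb
      exact absurd (WithTop.coe_le_coe.1 (hrv.trans (hpb.f_le.trans (z ⊔ y).f_le))) hlt.not_ge
  have hyb : T.Below y.base z.base := hbase ▸ (le_sup_right : y ≤ z ⊔ y).2
  rcases hyb.eq_or with h | ⟨p, hp, hpb⟩
  · exact ⟨hzy, h ▸ Relation.ReflTransGen.refl⟩
  · exact absurd hzy (WithTop.coe_lt_coe.1
      ((y.lt_f p hp).trans_le (hpb.f_le.trans z.f_le))).not_ge

theorem abs_height_sub_le_dist (x y : T.Point) : |x.height - y.height| ≤ dist x y := by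
  have h1 := height_mono (le_sup_left : x ≤ x ⊔ y)
  have h2 := height_mono (le_sup_right : y ≤ x ⊔ y)
  rw [dist_def, abs_le]
  constructor <;> linarith

theorem continuous_height : Continuous (height : T.Point → ℝ) :=
  (LipschitzWith.of_dist_le_mul (K := 1) fun x y => by
    simpa [Real.dist_eq] using abs_height_sub_le_dist x y).continuous

theorem dist_of_le {x y : T.Point} (h : x ≤ y) : dist x y = y.height - x.height := by
  rw [dist_def, sup_eq_right.2 h]
  ring

theorem le_iff_dist_eq {x y : T.Point} : x ≤ y ↔ dist x y = y.height - x.height := by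
  refine ⟨dist_of_le, fun h => ?_⟩
  rw [dist_def] at h
  exact sup_eq_right.1 (eq_of_le_of_height_le le_sup_right (by linarith)).symm

/-- Ancestors of `x` are the equality case of an inequality between continuous functions, height
difference ≤ distance. -/
theorem isClosed_Ici (x : T.Point) : IsClosed (Set.Ici x) := by
  have : Set.Ici x = {y | dist x y = y.height - x.height} := Set.ext fun y => le_iff_dist_eq
  rw [this]
  exact isClosed_eq (continuous_const.dist continuous_id) (continuous_height.sub continuous_const)

end Point

/-! ### Height-shifting maps: continuity and monotonicity -/

/-- A continuous map of metric trees which shifts heights by a constant preserves ancestors. -/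
theorem monotone_of_continuous {T T' : MergeTree} {δ : ℝ} {α : T.Point → T'.Point}
    (hc : Continuous α) (hδ : ∀ x, (α x).height - x.height = δ) : Monotone α := by
  intro x y hxy
  have hp : ∀ t : Set.Ici x.height, ∃ z, x ≤ z ∧ z.height = t := fun t => x.exists_ancestor t.2
  choose p hxp hph using hp
  have hmono : ∀ s t, s ≤ t → p s ≤ p t := fun s t h =>
    Point.le_of_le_of_height_le (hxp s) (hxp t) (by rw [hph, hph]; exact h)
  have hpc : Continuous p := by
    refine (LipschitzWith.of_dist_le_mul (K := 1) fun s t => ?_).continuous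
    wlog h : s ≤ t generalizing s t
    · rw [dist_comm, dist_comm s]
      exact this t s (le_of_not_ge h)
    · rw [Point.dist_of_le (hmono s t h), hph, hph, dist_comm, Subtype.dist_eq, Real.dist_eq]
      simpa using le_abs_self ((t : ℝ) - s)
  -- The image under `α` of the upward ray from `x`, parametrized by height; clamping makes it a map
  -- on all of `ℝ`.
  let q : ℝ → T'.Point := fun t => α (p ⟨max t x.height, Set.mem_Ici.2 (le_max_right _ _)⟩)
  have hqc : Continuous q := by
    refine hc.comp (hpc.comp ?_)
    fun_prop
  have hqh : ∀ t, x.height ≤ t → (q t).height = t + δ := by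
    intro t ht
    have := hδ (p ⟨max t x.height, Set.mem_Ici.2 (le_max_right _ _)⟩)
    rw [hph] at this
    simp only [max_eq_left ht] at this
    simp only [q, max_eq_left ht]
    linarith
  have hq : ∀ z (hz : x ≤ z), q z.height = α z := by
    intro z hz
    refine congrArg α ?_
    exact Point.eq_of_le_of_height_eq (hxp _) hz (by rw [hph]; exact max_eq_left hz.1)
  -- The heights where the curve is above `α x` form a closed set, which is open to the right
  -- because nearby points that are not lower are ancestors. Hence it contains the whole interval.
  have hsub : Set.Icc x.height y.height ⊆ {t | α x ≤ q t} := by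
    refine IsClosed.Icc_subset_of_forall_mem_nhdsWithin ?_ ?_ ?_
    · exact ((Point.isClosed_Ici (α x)).preimage hqc).inter isClosed_Icc
    · exact (hq x le_rfl).ge
    · rintro t ⟨ht, htx, -⟩
      obtain ⟨r, hr, hz⟩ := (q t).exists_forall_le_of_dist_lt
      have hnhds : ∀ᶠ s in 𝓝[>] t, dist (q s) (q t) < r :=
        nhdsWithin_le_nhds (hqc.continuousAt.eventually (Metric.ball_mem_nhds _ hr))
      filter_upwards [hnhds, self_mem_nhdsWithin] with s hs hts
      refine le_trans ht (hz _ (by rwa [dist_comm]) ?_)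
      rw [hqh t htx, hqh s (htx.trans (le_of_lt hts))]
      exact add_le_add_left (le_of_lt hts) _
  have := hsub ⟨hxy.1, le_rfl⟩
  rwa [Set.mem_ofPred_eq, hq y hxy] at this

/-- A map of metric trees which preserves ancestors and shifts heights by a constant is
continuous. -/
theorem continuous_of_monotone {T T' : MergeTree} {δ : ℝ} {α : T.Point → T'.Point}
    (hm : Monotone α) (hδ : ∀ x, (α x).height - x.height = δ) : Continuous α := by
  refine (LipschitzWith.of_dist_le_mul (K := 1) fun x y => ?_).continuous
  -- `α (x ⊔ y)` is a common ancestor of both images, so `α` is 1-Lipschitz.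
  have h := Point.height_mono (sup_le (hm (le_sup_left : x ≤ x ⊔ y)) (hm le_sup_right))
  have h1 := hδ x
  have h2 := hδ y
  have h3 := hδ (x ⊔ y)
  rw [Point.dist_def, Point.dist_def, NNReal.coe_one, one_mul]
  linarith

/-! ### Labellings, and good maps from close matrices -/

/-- A family of points of `|T|` is a labelling with matrix `U` if every point is an ancestor of
a member of the family, and `U i j` is the height of the lowest common ancestor of the `i`-th and
the `j`-th point. -/
structure IsLabelling {ι : Type} (T : MergeTree) (a : ι → T.Point) (U : ι → ι → ℝ) : Prop where
  exists_le : ∀ x, ∃ i, a i ≤ x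
  height_sup : ∀ i j, (a i ⊔ a j).height = U i j

theorem IsLabelling.height {ι : Type} {T : MergeTree} {a : ι → T.Point} {U : ι → ι → ℝ}
    (h : IsLabelling T a U) (i : ι) : (a i).height = U i i := by
  rw [← h.height_sup, sup_idem]

/-- Two labelled merge trees are related by a good map if their matrices are close. -/
theorem IsLabelling.exists_isGood {ι : Type} [Finite ι] {T S : MergeTree} {a : ι → T.Point}
    {b : ι → S.Point} {U U' : ι → ι → ℝ} (ha : IsLabelling T a U) (hb : IsLabelling S b U')
    {ε : ℝ} (hε : ∀ i j, |U i j - U' i j| ≤ ε) : ∃ α : T.Point → S.Point, IsGood ε α := by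
  have hup : ∀ i j, U' i j ≤ U i j + ε := fun i j => by linarith [(abs_le.1 (hε i j)).1]
  have hdown : ∀ i j, U i j ≤ U' i j + ε := fun i j => by linarith [(abs_le.1 (hε i j)).2]
  -- The image of `x` is the ancestor, at height `x.height + ε`, of `b i` for any label `i` below
  -- `x`. The choice of `i` is immaterial: labels that have merged by height `x.height` in `T` have
  -- merged by `x.height + ε` in `S`.
  have hex : ∀ x : T.Point, ∃ y : S.Point, y.height = x.height + ε ∧ ∀ i, a i ≤ x → b i ≤ y := by
    intro x
    obtain ⟨i, hi⟩ := ha.exists_le x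
    obtain ⟨y, hiy, hy⟩ := (b i).exists_ancestor (t := x.height + ε) (by
      rw [hb.height]
      have := Point.height_mono hi
      rw [ha.height] at this
      linarith [hup i i])
    refine ⟨y, hy, fun j hj => le_sup_right.trans
      (Point.le_of_le_of_height_le (le_sup_left : b i ≤ b i ⊔ b j) hiy ?_)⟩
    have := Point.height_mono (sup_le hi hj)
    rw [ha.height_sup] at this
    rw [hb.height_sup, hy]
    linarith [hup i j]
  choose α hαh hα using hex
  have hshift : ∀ x, (α x).height - x.height = ε := fun x => by rw [hαh]; ring
  refine ⟨α, continuous_of_monotone (fun x y hxy => ?_) hshift, hshift, ?_, ?_⟩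
  · obtain ⟨i, hi⟩ := ha.exists_le x
    refine Point.le_of_le_of_height_le (hα x i hi) (hα y i (hi.trans hxy)) ?_
    rw [hαh, hαh]
    linarith [hxy.1]
  · rintro _ ⟨u₀, rfl⟩
    have hh : ∀ u ∈ α ⁻¹' {α u₀}, u.height = u₀.height := by
      intro u hu
      have h := congrArg Point.height (Set.mem_singleton_iff.1 hu)
      rw [hαh, hαh] at h
      linarith
    choose l hl using ha.exists_le
    -- Points of a fibre have equal height, so each is determined by a label below it.
    have hfin : (α ⁻¹' {α u₀}).Finite := by
      refine Set.Finite.of_finite_image (f := l) (Set.toFinite _) fun u hu v hv huv => ?_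
      exact Point.eq_of_le_of_height_eq (hl u) (huv ▸ hl v) ((hh u hu).trans (hh v hv).symm)
    -- Labels below two points of the fibre merge in `S` by height `u₀.height + ε`, hence in `T` by
    -- `u₀.height + 2 * ε`; so `p` bounds the whole fibre.
    obtain ⟨p, hp, hph⟩ := u₀.exists_ancestor (t := u₀.height + 2 * ε) (by
      linarith [(abs_nonneg _).trans (hε (l u₀) (l u₀))])
    have hle : ∀ u ∈ α ⁻¹' {α u₀}, u ≤ p := by
      intro u hu
      have h1 : b (l u) ⊔ b (l u₀) ≤ α u₀ :=
        sup_le ((hα u _ (hl u)).trans_eq hu) (hα u₀ _ (hl u₀))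
      have h2 : a (l u) ⊔ a (l u₀) ≤ p := by
        refine Point.le_of_le_of_height_le (le_sup_right : a (l u₀) ≤ _) ((hl u₀).trans hp) ?_
        have := Point.height_mono h1
        rw [hb.height_sup, hαh] at this
        rw [ha.height_sup, hph]
        linarith [hdown (l u) (l u₀)]
      refine Point.le_of_le_of_height_le (hl u) (le_sup_left.trans h2) ?_
      rw [hh u hu]
      exact hp.1
    have hne : hfin.toFinset.Nonempty := ⟨u₀, by simp⟩
    refine ⟨hfin.toFinset.sup' hne id, ?_, fun u hu => ?_⟩
    · simpa using Finset.isLUB_sup' hne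
    · have h1 : hfin.toFinset.sup' hne id ≤ p :=
        Finset.sup'_le _ _ fun v hv => hle v (by simpa using hv)
      have h2 := Point.height_mono h1
      rw [hph] at h2
      rw [hh u hu]
      linarith
  · intro w hw
    refine csSup_le (Set.Nonempty.image _ ⟨w, Set.mem_Iic.2 le_rfl⟩) ?_
    rintro _ ⟨u, hu, rfl⟩
    by_contra! hlt
    obtain ⟨i, hi⟩ := hb.exists_le u
    -- If `u` is more than `2 * ε` below `w`, then `a i` lies below height `w.height - ε`, and its
    -- ancestor at that height is mapped to `w`.
    obtain ⟨x, hix, hx⟩ := (a i).exists_ancestor (t := w.height - ε) (by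
      have := Point.height_mono hi
      rw [hb.height] at this
      rw [ha.height]
      linarith [hdown i i])
    refine hw ⟨x, Point.eq_of_le_of_height_eq (hα x i hix) (hi.trans hu) ?_⟩
    rw [hαh, hx]
    ring

/-! ### From a good map to labellings with close matrices -/

theorem IsGood.nonneg {T T' : MergeTree} {δ : ℝ} {α : T.Point → T'.Point} (h : IsGood δ α) :
    0 ≤ δ := by
  obtain ⟨x⟩ : Nonempty T.Point := inferInstance
  obtain ⟨x', hx', hb⟩ := h.fibre (α x) ⟨x, rfl⟩
  have h1 := hb x rfl
  have h2 := Point.height_mono (hx'.1 (show x ∈ α ⁻¹' {α x} from rfl))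
  linarith

/-- Ancestors lift along `α`, because a point has only one ancestor at each height. In particular
the image is closed upwards. -/
theorem IsGood.mem_range_of_le {T T' : MergeTree} {δ : ℝ} {α : T.Point → T'.Point}
    (h : IsGood δ α) {x : T.Point} {y : T'.Point} (hxy : α x ≤ y) :
    ∃ z, x ≤ z ∧ α z = y := by
  obtain ⟨z, hxz, hz⟩ := x.exists_ancestor (t := y.height - δ) (by
    linarith [h.shift x, hxy.1])
  refine ⟨z, hxz, Point.eq_of_le_of_height_eq
    (monotone_of_continuous h.continuous h.shift hxz) hxy ?_⟩
  linarith [h.shift z]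

/-- Every point has a lowest ancestor in the image of a good map. -/
theorem IsGood.exists_isLeast {T T' : MergeTree} {δ : ℝ} {α : T.Point → T'.Point}
    (h : IsGood δ α) (b : T'.Point) :
    ∃ c, IsLeast (Set.range α ∩ Set.Ici b) c ∧ c.height - b.height ≤ 2 * δ := by
  have hm := monotone_of_continuous h.continuous h.shift
  obtain ⟨r, hr, -⟩ := T.exists_top_vertex
  have : Nonempty {v // v ≠ T.root} := ⟨⟨r, hr⟩⟩
  -- Every `α x` is above the image of the vertex at the base of `x`, so finitely many candidates
  -- suffice.
  obtain ⟨v, hv⟩ := Finite.exists_min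
    fun v : {v // v ≠ T.root} => (b ⊔ α (Point.ofVertex v.1 v.2)).height
  have hleast : IsLeast (Set.range α ∩ Set.Ici b) (b ⊔ α (Point.ofVertex v.1 v.2)) := by
    refine ⟨⟨?_, Set.mem_Ici.2 le_sup_left⟩, ?_⟩
    · obtain ⟨z, -, hz⟩ := h.mem_range_of_le
        (le_sup_right : α (Point.ofVertex v.1 v.2) ≤ b ⊔ _)
      exact ⟨z, hz⟩
    · rintro _ ⟨⟨x, rfl⟩, hx⟩
      have h1 : b ⊔ α (Point.ofVertex x.base x.base_ne_root) ≤ α x :=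
        sup_le hx (hm x.ofVertex_base_le)
      exact Point.le_of_le_of_height_le le_sup_left hx
        ((hv ⟨x.base, x.base_ne_root⟩).trans h1.1)
  refine ⟨_, hleast, ?_⟩
  set c := b ⊔ α (Point.ofVertex v.1 v.2)
  -- The points from `b` up to, but excluding, `c` are outside the image, and their depth bounds
  -- their height above `b`. The bound for `c` follows in the limit.
  have key : ∀ t, b.height ≤ t → t < c.height → t - b.height ≤ 2 * δ := by
    intro t ht htc
    obtain ⟨y, hby, rfl⟩ := b.exists_ancestor ht
    have hy : y ∉ Set.range α := fun hy => htc.not_ge (hleast.2 ⟨hy, hby⟩).1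
    exact (le_csSup y.depth_bddAbove ⟨b, hby, rfl⟩).trans (h.depth_le y hy)
  by_contra! hlt
  have := key (max b.height ((c.height + (b.height + 2 * δ)) / 2)) (le_max_left _ _)
    (max_lt (by linarith [h.nonneg]) (by linarith))
  have := le_max_right b.height ((c.height + (b.height + 2 * δ)) / 2)
  linarith

/-- A good map gives labellings of both trees, by the same labels, with close matrices. -/
theorem IsGood.exists_isLabelling {T T' : MergeTree} {δ : ℝ} {α : T.Point → T'.Point}
    (h : IsGood δ α) :
    ∃ (ι : Type) (_ : Finite ι) (_ : Nonempty ι) (a : ι → T.Point) (b : ι → T'.Point)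
      (U U' : ι → ι → ℝ), IsLabelling T a U ∧ IsLabelling T' b U' ∧
        ∀ i j, |U i j - U' i j| ≤ δ := by
  have hm := monotone_of_continuous h.continuous h.shift
  choose c hc hcb using h.exists_isLeast
  -- One preimage is fixed for each point of the image, so that labels with the same lowest ancestor
  -- in the image receive the same point of `T`.
  choose! σ hσ using show ∀ y : T'.Point, y ∈ Set.range α → ∃ x, α x = y from fun y hy => hy
  -- A vertex of `T` labels itself and its image. A vertex of `T'` labels itself and the chosen
  -- preimage of its lowest ancestor in the image.
  let ι := {v // v ≠ T.root} ⊕ {v // v ≠ T'.root}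
  let b : ι → T'.Point :=
    Sum.elim (fun v => α (Point.ofVertex v.1 v.2)) fun w => Point.ofVertex w.1 w.2
  let a : ι → T.Point :=
    Sum.elim (fun v => Point.ofVertex v.1 v.2) fun w => σ (c (Point.ofVertex w.1 w.2))
  have hcα : ∀ x, c (α x) = α x := fun x =>
    (hc (α x)).unique ⟨⟨⟨x, rfl⟩, Set.mem_Ici.2 le_rfl⟩, fun _ hy => hy.2⟩
  have hac : ∀ i, α (a i) = c (b i) := by
    rintro (v | w)
    · exact (hcα _).symm
    · exact hσ _ (hc _).1.1
  have haσ : ∀ i, b i ≠ c (b i) → a i = σ (c (b i)) := by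
    rintro (v | w) hi
    · exact absurd (hcα _).symm hi
    · rfl
  have hbc : ∀ i, b i ≤ c (b i) := fun i => (hc (b i)).1.2
  obtain ⟨r, hr, -⟩ := T.exists_top_vertex
  refine ⟨ι, inferInstance, ⟨Sum.inl ⟨r, hr⟩⟩, a, b, _, _,
    ⟨fun x => ⟨Sum.inl ⟨x.base, x.base_ne_root⟩, x.ofVertex_base_le⟩, fun _ _ => rfl⟩,
    ⟨fun x => ⟨Sum.inr ⟨x.base, x.base_ne_root⟩, x.ofVertex_base_le⟩, fun _ _ => rfl⟩, ?_⟩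
  have hlow : ∀ i j, (b i ⊔ b j).height ≤ (a i ⊔ a j).height + δ := by
    intro i j
    have h1 : b i ⊔ b j ≤ α (a i ⊔ a j) :=
      sup_le ((hbc i).trans ((hac i).ge.trans (hm le_sup_left)))
        ((hbc j).trans ((hac j).ge.trans (hm le_sup_right)))
    linarith [h1.1, h.shift (a i ⊔ a j)]
  have hrange : ∀ i q, c (b i) ≤ q → q ∈ Set.range α := fun i q hq =>
    let ⟨z, _, hz⟩ := h.mem_range_of_le ((hac i).trans_le hq)
    ⟨z, hz⟩
  -- if the lowest common ancestor is not in the image, both labels come from the same point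
  have hout : ∀ i j, (b i ⊔ b j).height < (c (b i)).height →
      (a i ⊔ a j).height ≤ (b i ⊔ b j).height + δ := by
    intro i j hlt
    have hnot : b i ⊔ b j ∉ Set.range α := fun hq =>
      hlt.not_ge ((hc (b i)).2 ⟨hq, Set.mem_Ici.2 le_sup_left⟩).1
    have hqi : b i ⊔ b j ≤ c (b i) := Point.le_of_le_of_height_le le_sup_left (hbc i) hlt.le
    have hqj : b i ⊔ b j ≤ c (b j) :=
      (Point.total_of_le le_sup_right (hbc j)).resolve_right fun hq => hnot (hrange j _ hq)
    have hcc : c (b i) = c (b j) := le_antisymm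
      ((hc (b i)).2 ⟨(hc (b j)).1.1, le_sup_left.trans hqj⟩)
      ((hc (b j)).2 ⟨(hc (b i)).1.1, le_sup_right.trans hqi⟩)
    have hi : b i ≠ c (b i) := fun he => hnot (hrange i _ (he ▸ le_sup_left))
    have hj : b j ≠ c (b j) := fun he => hnot (hrange j _ (he ▸ le_sup_right))
    have haa : a i = a j := by rw [haσ i hi, haσ j hj, hcc]
    -- The common label is δ below `c (b i)`, which is at most `2 * δ` above `b i`.
    have h1 := h.shift (a i)
    rw [hac] at h1
    rw [← haa, sup_idem]
    linarith [hcb (b i), Point.height_mono (le_sup_left : b i ≤ b i ⊔ b j)]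
  have hhigh : ∀ i j, (a i ⊔ a j).height ≤ (b i ⊔ b j).height + δ := by
    intro i j
    rcases lt_or_ge (b i ⊔ b j).height (c (b i)).height with hi | hi
    · exact hout i j hi
    rcases lt_or_ge (b i ⊔ b j).height (c (b j)).height with hj | hj
    · rw [sup_comm (a i), sup_comm (b i)]
      exact hout j i (by rwa [sup_comm])
    -- Here the merging point lies above `α (a i)` and `α (a j)`, so it has preimages `x` above `a
    -- i` and `y` above `a j`. The fibre condition puts a common ancestor of them at most `2 * δ`
    -- above `x`, that is, at most δ above the merging height.
    obtain ⟨x, hx, hxq⟩ := h.mem_range_of_le ((hac i).trans_le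
      (Point.le_of_le_of_height_le (hbc i) (le_sup_left : b i ≤ b i ⊔ b j) hi))
    obtain ⟨y, hy, hyq⟩ := h.mem_range_of_le ((hac j).trans_le
      (Point.le_of_le_of_height_le (hbc j) (le_sup_right : b j ≤ b i ⊔ b j) hj))
    obtain ⟨z, hz, hzb⟩ := h.fibre (b i ⊔ b j) ⟨x, hxq⟩
    have h1 : a i ⊔ a j ≤ z := sup_le (hx.trans (hz.1 hxq)) (hy.trans (hz.1 hyq))
    have h2 := hzb x hxq
    have h3 := h.shift x
    rw [hxq] at h3
    linarith [h1.1]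
  intro i j
  rw [abs_le]
  constructor <;> linarith [hlow i j, hhigh i j]

end MergeTree

/-! ### Merge trees from a parent relation -/

namespace MergeTree

/-- The merge tree with a given relation "`v` is the higher endpoint of an edge `uv`". -/
def ofUp (V : Type) [Finite V] (f : V → WithTop ℝ) (up : V → V → Prop) (root : V)
    (f_lt : ∀ u v, up u v → f u < f v) (existsUnique_up : ∀ v, v ≠ root → ∃! w, up v w)
    (root_down : ∃! w, up w root) (f_eq_top_iff : ∀ v, f v = ⊤ ↔ v = root) : MergeTree :=
  let G : SimpleGraph V :=
    { Adj := fun u v => up u v ∨ up v u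
      symm := ⟨fun _ _ h => h.symm⟩
      loopless := ⟨fun v h => lt_irrefl _ (f_lt v v (h.elim id id))⟩ }
  have hroot : ∀ v, ¬ up root v := fun v h =>
    not_top_lt (((f_eq_top_iff root).2 rfl) ▸ f_lt root v h)
  have hG : ∀ u v, G.Adj u v ∧ f u < f v ↔ up u v := fun u v =>
    ⟨fun h => h.1.resolve_right fun h' => lt_asymm h.2 (f_lt v u h'),
      fun h => ⟨Or.inl h, f_lt u v h⟩⟩
  { V := V
    finite := inferInstance
    G := G
    root := root
    f := f
    isTree := by
      have hreach : ∀ v, G.Reachable v root := by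
        have wf : WellFounded (fun a b : V => f b < f a) :=
          @Finite.wellFounded_of_trans_of_irrefl _ _ _
            ⟨fun _ _ _ h h' => lt_trans h' h⟩ ⟨fun _ h => lt_irrefl _ h⟩
        intro v
        induction v using wf.induction with
        | _ v ih =>
          by_cases hv : v = root
          · rw [hv]
          · obtain ⟨p, hp, -⟩ := existsUnique_up v hv
            have hadj : G.Adj v p := Or.inl hp
            exact hadj.reachable.trans (ih p (f_lt v p hp))
      have hconn : G.Connected :=
        { preconnected := fun u v => (hreach u).trans (hreach v).symm
          nonempty := ⟨root⟩ }
      choose! p hp hpu using existsUnique_up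
      -- Each edge is the unique upward edge of its lower end, so there are at most `|V| - 1` edges;
      -- a connected graph with that few edges is a tree.
      have hsurj : Function.Surjective fun v : {v // v ≠ root} =>
          (⟨s(v.1, p v.1), Or.inl (hp v.1 v.2)⟩ : G.edgeSet) := by
        have key : ∀ u v, up u v → ∃ a : {v // v ≠ root}, s(a.1, p a.1) = s(u, v) := by
          intro u v h
          have hu : u ≠ root := fun hu => hroot v (hu ▸ h)
          exact ⟨⟨u, hu⟩, by rw [hpu u hu v h]⟩
        rintro ⟨e, he⟩
        induction e using Sym2.ind with
        | _ u v =>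
          rcases he with h | h
          · obtain ⟨a, ha⟩ := key u v h
            exact ⟨a, Subtype.ext ha⟩
          · obtain ⟨a, ha⟩ := key v u h
            exact ⟨a, Subtype.ext (ha.trans Sym2.eq_swap)⟩
      have h1 := Nat.card_le_card_of_surjective _ hsurj
      have h2 : Nat.card {v // v ≠ root} + 1 = Nat.card V := by
        classical
        rw [← Finite.card_option]
        exact Nat.card_congr (Equiv.optionSubtypeNe root)
      refine SimpleGraph.isTree_iff_connected_and_card.2 ⟨hconn, le_antisymm ?_ ?_⟩
      · exact (Nat.add_le_add_right h1 1).trans_eq h2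
      · exact hconn.card_vert_le_card_edgeSet_add_one
    f_ne_of_adj := fun u v h =>
      h.elim (fun h => (f_lt u v h).ne) fun h => (f_lt v u h).ne'
    existsUnique_higher := fun v hv => by simpa only [hG] using existsUnique_up v hv
    root_degree_one := by
      obtain ⟨w, hw, hwu⟩ := root_down
      exact ⟨w, Or.inr hw, fun y hy => hwu y (hy.resolve_left (hroot y))⟩
    f_eq_top_iff := f_eq_top_iff }

end MergeTree

/-! ### The merge tree of an ultrametric matrix -/

/-- A symmetric matrix which satisfies the strong triangle inequality (with arbitrary diagonal). -/
structure IsUltraMatrix {ι : Type} (U : ι → ι → ℝ) : Prop where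
  symm : ∀ i j, U i j = U j i
  le_max : ∀ i j k, U i k ≤ max (U i j) (U j k)

namespace IsUltraMatrix

variable {ι : Type} {U : ι → ι → ℝ}

/-- The heights of the vertices of the merge tree of a matrix. -/
def levels (U : ι → ι → ℝ) : Set (WithTop ℝ) :=
  insert ⊤ (Set.range fun p : ι × ι => (U p.1 p.2 : WithTop ℝ))

/-- The labels which merge with `i` at height at most `r`. -/
def cluster (U : ι → ι → ℝ) (i : ι) (r : WithTop ℝ) : Set ι := {j | (U i j : WithTop ℝ) ≤ r}

/-- The vertices of the merge tree of a matrix: the nonempty clusters at each level. -/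
def Vertex (U : ι → ι → ℝ) : Type :=
  {p : Set ι × WithTop ℝ // p.2 ∈ levels U ∧ ∃ i ∈ p.1, p.1 = cluster U i p.2}

theorem finite_levels [Finite ι] : (levels U).Finite := (Set.finite_range _).insert _

instance [Finite ι] : Finite (Vertex U) := by
  refine Set.Finite.subset (Set.toFinite (Set.univ : Set (Set ι)) |>.prod
    (finite_levels (U := U))) ?_
  rintro p ⟨hp, -⟩
  exact ⟨trivial, hp⟩

/-- The cluster of `i` at the level of the vertex `q` has the same level and contains `p`. -/
def Vertex.Up (p q : Vertex U) : Prop :=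
  p.1.1 ⊆ q.1.1 ∧ p.1.2 < q.1.2 ∧ ∀ s ∈ levels U, p.1.2 < s → q.1.2 ≤ s

theorem le_of_le_of_le (hU : IsUltraMatrix U) {i j k : ι} {r : WithTop ℝ}
    (h : (U i j : WithTop ℝ) ≤ r) (h' : (U j k : WithTop ℝ) ≤ r) : (U i k : WithTop ℝ) ≤ r := by
  refine (WithTop.coe_le_coe.2 (hU.le_max i j k)).trans ?_
  rcases max_choice (U i j) (U j k) with e | e <;> rw [e] <;> assumption

theorem diag_le (hU : IsUltraMatrix U) (i j : ι) : U i i ≤ U i j := by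
  simpa [hU.symm j i] using hU.le_max i j i

theorem cluster_eq (hU : IsUltraMatrix U) {i j : ι} {r : WithTop ℝ} (h : j ∈ cluster U i r) :
    cluster U j r = cluster U i r := by
  ext k
  exact ⟨fun hk => hU.le_of_le_of_le h hk,
    fun hk => hU.le_of_le_of_le (hU.symm i j ▸ h) hk⟩

theorem Vertex.eq_cluster (hU : IsUltraMatrix U) (p : Vertex U) {i : ι} (hi : i ∈ p.1.1) :
    p.1.1 = cluster U i p.1.2 := by
  obtain ⟨-, j, -, hj⟩ := p.2
  rw [hj] at hi
  rw [hU.cluster_eq hi, ← hj]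

theorem Vertex.eq_of_mem (hU : IsUltraMatrix U) {p q : Vertex U} {i : ι} (hp : i ∈ p.1.1)
    (hq : i ∈ q.1.1) (h : p.1.2 = q.1.2) : p = q :=
  Subtype.ext (Prod.ext (by rw [p.eq_cluster hU hp, q.eq_cluster hU hq, h]) h)

/-- The vertex given by the cluster of `i` at level `r`. -/
def vertexOf (i : ι) (r : WithTop ℝ) (hr : r ∈ levels U) (hi : (U i i : WithTop ℝ) ≤ r) :
    Vertex U :=
  ⟨(cluster U i r, r), hr, i, hi, rfl⟩

theorem Vertex.diag_le {p : Vertex U} (hU : IsUltraMatrix U) {i : ι} (hi : i ∈ p.1.1) :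
    (U i i : WithTop ℝ) ≤ p.1.2 := by
  rw [p.eq_cluster hU hi] at hi
  exact hi

/-- The parent is the cluster of the same labels at the next level. Every cluster is a vertex at
every level it reaches, even where nothing merges; the redundant vertices only subdivide edges. -/
theorem Vertex.existsUnique_up [Finite ι] (hU : IsUltraMatrix U) (p : Vertex U)
    (hp : p.1.2 ≠ ⊤) : ∃! q, p.Up q := by
  obtain ⟨i, hi, hpi⟩ := p.2.2
  obtain ⟨s, ⟨hs, hps⟩, hmin⟩ := Set.exists_min_image {s ∈ levels U | p.1.2 < s} id
    (finite_levels.subset (Set.sep_subset _ _)) ⟨⊤, Set.mem_insert _ _, lt_top_iff_ne_top.2 hp⟩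
  refine ⟨vertexOf i s hs ((Vertex.diag_le hU hi).trans hps.le),
    ⟨?_, hps, fun t ht hpt => hmin t ⟨ht, hpt⟩⟩, ?_⟩
  · rw [hpi]
    exact fun j hj => le_trans hj hps.le
  · intro q hq
    refine Vertex.eq_of_mem hU (hq.1 hi) ((Vertex.diag_le hU hi).trans hps.le) ?_
    exact le_antisymm (hq.2.2 s hs hps) (hmin _ ⟨q.2.1, hq.2.1⟩)

/-- At the level of the largest entry all labels lie in one cluster, and this is the highest level
below `⊤`. -/
theorem Vertex.existsUnique_down [Finite ι] [Nonempty ι] (hU : IsUltraMatrix U) {q : Vertex U}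
    (hq : q.1.2 = ⊤) : ∃! p : Vertex U, p.Up q := by
  obtain ⟨m, hm⟩ := Finite.exists_max fun p : ι × ι => U p.1 p.2
  have hmem : ((U m.1 m.2 : ℝ) : WithTop ℝ) ∈ levels U := Set.mem_insert_of_mem _ ⟨m, rfl⟩
  obtain ⟨i₀⟩ := ‹Nonempty ι›
  have hq' : ∀ i, i ∈ q.1.1 := by
    obtain ⟨-, i, -, hi⟩ := q.2
    rw [hi, hq]
    exact fun j => le_top (a := (U i j : WithTop ℝ))
  have hlevel : ∀ s ∈ levels U, (U m.1 m.2 : WithTop ℝ) < s → ⊤ ≤ s := by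
    rintro s (rfl | ⟨p, rfl⟩) h
    · exact le_rfl
    · exact absurd (hm p) (WithTop.coe_lt_coe.1 h).not_ge
  refine ⟨vertexOf i₀ _ hmem (WithTop.coe_le_coe.2 (hm (i₀, i₀))), ⟨fun j _ => hq' j, ?_, ?_⟩, ?_⟩
  · rw [hq]
    exact WithTop.coe_lt_top _
  · rw [hq]
    exact hlevel
  · intro p hp
    have h2 : p.1.2 = (U m.1 m.2 : WithTop ℝ) := by
      have hlt := hp.2.1
      refine le_antisymm ?_ ?_
      · obtain ⟨h, -⟩ := p.2
        rcases h with h | ⟨x, hx⟩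
        · rw [h] at hlt
          exact absurd hlt not_top_lt
        · rw [← hx]
          exact WithTop.coe_le_coe.2 (hm x)
      · by_contra! hlt'
        have := hp.2.2 _ hmem hlt'
        rw [hq] at this
        exact absurd this (WithTop.coe_lt_top _).not_ge
    obtain ⟨i, hi, hpi⟩ := p.2.2
    refine Vertex.eq_of_mem hU hi ?_ h2
    exact WithTop.coe_le_coe.2 (hm (i₀, i))

/-- The merge tree of an ultrametric matrix. -/
noncomputable def mergeTree [Finite ι] [Nonempty ι] (hU : IsUltraMatrix U) : MergeTree :=
  have hroot : ∀ v : Vertex U, v.1.2 = ⊤ ↔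
      v = vertexOf (Classical.arbitrary ι) ⊤ (Set.mem_insert _ _) le_top := by
    refine fun v => ⟨fun h => ?_, fun h => by rw [h]; rfl⟩
    obtain ⟨i, hi, -⟩ := v.2.2
    exact Vertex.eq_of_mem hU hi (le_top (a := (U _ i : WithTop ℝ))) h
  MergeTree.ofUp (Vertex U) (fun p => p.1.2) Vertex.Up
    (vertexOf (Classical.arbitrary ι) ⊤ (Set.mem_insert _ _) le_top) (fun _ _ h => h.2.1)
    (fun v hv => v.existsUnique_up hU fun h => hv ((hroot v).1 h))
    (Vertex.existsUnique_down hU rfl) hroot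

section

variable [Finite ι] [Nonempty ι] (hU : IsUltraMatrix U)

theorem up_mergeTree_iff (p q : Vertex U) : hU.mergeTree.Up p q ↔ p.Up q :=
  ⟨fun h => h.1.resolve_right fun h' => lt_asymm h.2 h'.2.1, fun h => ⟨Or.inl h, h.2.1⟩⟩

theorem subset_of_below {p q : Vertex U} (h : hU.mergeTree.Below p q) : p.1.1 ⊆ q.1.1 := by
  induction h with
  | refl => exact subset_rfl
  | tail _ h ih => exact ih.trans ((hU.up_mergeTree_iff _ _).1 h).1

/-- Climbing from `p` one level at a time keeps the label `i` and cannot skip the level of `q`; at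
that level only one cluster contains `i`. -/
theorem below_of_mem {p q : Vertex U} {i : ι} (hp : i ∈ p.1.1) (hq : i ∈ q.1.1)
    (h : p.1.2 ≤ q.1.2) : hU.mergeTree.Below p q := by
  have wf : WellFounded (fun a b : Vertex U => b.1.2 < a.1.2) :=
    @Finite.wellFounded_of_trans_of_irrefl _ _ _
      ⟨fun _ _ _ h h' => lt_trans h' h⟩ ⟨fun _ h => lt_irrefl _ h⟩
  induction p using wf.induction with
  | _ p ih =>
    rcases h.eq_or_lt with h | h
    · rw [Vertex.eq_of_mem hU hp hq h]
      exact Relation.ReflTransGen.refl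
    · obtain ⟨r, hr, -⟩ := p.existsUnique_up hU h.ne_top
      exact Relation.ReflTransGen.head ((hU.up_mergeTree_iff p r).2 hr)
        (ih r hr.2.1 (hr.1 hp) (hr.2.2 _ q.2.1 h))

/-- The point where the labels `i` and `j` merge. -/
noncomputable def mergePoint (i j : ι) : hU.mergeTree.Point where
  base := vertexOf i (U i j) (Set.mem_insert_of_mem _ ⟨(i, j), rfl⟩)
    (WithTop.coe_le_coe.2 (hU.diag_le i j))
  height := U i j
  f_le := le_rfl
  lt_f _ hv := ((hU.up_mergeTree_iff _ _).1 hv).2.1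

theorem mergePoint_le (i j k : ι) (hk : U i k ≤ U i j) (hk' : U k k ≤ U i j) :
    hU.mergePoint k k ≤ hU.mergePoint i j :=
  ⟨hk', hU.below_of_mem (i := k) (WithTop.coe_le_coe.2 le_rfl)
    (WithTop.coe_le_coe.2 hk) (WithTop.coe_le_coe.2 hk')⟩

/-- Clusters grow upwards, so the base cluster of a common ancestor contains both `i` and `j`, which
forces its level to be at least `U i j`. -/
theorem isLUB_mergePoint (i j : ι) :
    IsLUB {hU.mergePoint i i, hU.mergePoint j j} (hU.mergePoint i j) := by
  have hj : U j j ≤ U i j := (hU.diag_le j i).trans_eq (hU.symm j i)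
  constructor
  · rintro _ (rfl | rfl)
    · exact hU.mergePoint_le i j i (hU.diag_le i j) (hU.diag_le i j)
    · exact hU.mergePoint_le i j j le_rfl hj
  · intro z hz
    have hzi := hz (Set.mem_insert _ _)
    have hzj := hz (Set.mem_insert_of_mem _ rfl)
    have hi : i ∈ (z.base : Vertex U).1.1 :=
      hU.subset_of_below hzi.2 (WithTop.coe_le_coe.2 le_rfl : (U i i : WithTop ℝ) ≤ U i i)
    have hj : j ∈ (z.base : Vertex U).1.1 :=
      hU.subset_of_below hzj.2 (WithTop.coe_le_coe.2 le_rfl : (U j j : WithTop ℝ) ≤ U j j)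
    have hij : (U i j : WithTop ℝ) ≤ (z.base : Vertex U).1.2 := by
      rwa [Vertex.eq_cluster hU _ hi] at hj
    exact ⟨WithTop.coe_le_coe.1 (hij.trans z.f_le), hU.below_of_mem (i := i)
      (WithTop.coe_le_coe.2 (hU.diag_le i j)) hi hij⟩

theorem isLabelling_mergePoint :
    MergeTree.IsLabelling hU.mergeTree (fun i => hU.mergePoint i i) U where
  exists_le x := by
    obtain ⟨-, i, hi, -⟩ := (x.base : Vertex U).2
    have h := Vertex.diag_le hU hi
    exact ⟨i, WithTop.coe_le_coe.1 (h.trans x.f_le),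
      hU.below_of_mem (i := i) (WithTop.coe_le_coe.2 le_rfl) hi h⟩
  height_sup i j := by rw [isLUB_pair.unique (hU.isLUB_mergePoint i j)]; rfl

end

end IsUltraMatrix

/-- The points `a i ⊔ a j` and `a j ⊔ a k` are ancestors of `a j`, hence comparable, and the higher
one is above both `a i` and `a k`. -/
theorem MergeTree.IsLabelling.isUltraMatrix {ι : Type} {T : MergeTree} {a : ι → T.Point}
    {U : ι → ι → ℝ} (h : IsLabelling T a U) : IsUltraMatrix U where
  symm i j := by rw [← h.height_sup, ← h.height_sup, sup_comm]
  le_max i j k := by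
    simp only [← h.height_sup]
    rcases Point.total_of_le (le_sup_right : a j ≤ a i ⊔ a j) (le_sup_left : a j ≤ a j ⊔ a k)
      with hle | hle
    · exact le_max_of_le_right
        (Point.height_mono (sup_le (le_sup_left.trans hle) le_sup_right))
    · exact le_max_of_le_left
        (Point.height_mono (sup_le le_sup_left (le_sup_right.trans hle)))

/-! ### The ultrametric closure of a matrix -/

/-- The largest ultrametric matrix below `M`: the minimum over all chains from `i` to `j` of the
largest entry along the chain. -/
noncomputable def ultraClosure {ι : Type} (M : ι → ι → ℝ) (i j : ι) : ℝ :=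
  sInf {r | Relation.TransGen (fun k l => M k l ≤ r) i j}

section ultraClosure

variable {ι : Type} {M N : ι → ι → ℝ}

/-- The strict inequality makes it unnecessary to know that the infimum is attained. -/
theorem transGen_of_ultraClosure_lt {r : ℝ} {i j : ι} (h : ultraClosure M i j < r) :
    Relation.TransGen (fun k l => M k l ≤ r) i j := by
  obtain ⟨s, hs, hsr⟩ := exists_lt_of_csInf_lt
    (s := {r | Relation.TransGen (fun k l => M k l ≤ r) i j})
    ⟨M i j, Relation.TransGen.single (show M i j ≤ M i j from le_rfl)⟩ h
  exact Relation.TransGen.mono (fun k l (hkl : M k l ≤ s) => hkl.trans hsr.le) _ _ hs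

variable [Finite ι]

/-- A chain has at least one link, so the smallest entry is a bound. Empty chains would make the set
for a diagonal entry unbounded below. -/
theorem bddBelow_ultraClosure (M : ι → ι → ℝ) (i j : ι) :
    BddBelow {r | Relation.TransGen (fun k l => M k l ≤ r) i j} := by
  have : Nonempty ι := ⟨i⟩
  obtain ⟨p, hp⟩ := Finite.exists_min fun p : ι × ι => M p.1 p.2
  refine ⟨M p.1 p.2, fun r hr => ?_⟩
  induction hr with
  | single h => exact (hp (i, _)).trans h
  | tail _ _ ih => exact ih

theorem ultraClosure_le {r : ℝ} {i j : ι} (h : Relation.TransGen (fun k l => M k l ≤ r) i j) :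
    ultraClosure M i j ≤ r :=
  csInf_le (bddBelow_ultraClosure M i j) h

theorem isUltraMatrix_ultraClosure (hM : ∀ i j, M i j = M j i) :
    IsUltraMatrix (ultraClosure M) where
  symm i j := by
    have key : ∀ i j, ultraClosure M j i ≤ ultraClosure M i j := by
      refine fun i j => le_of_forall_gt_imp_ge_of_dense fun r hr => ultraClosure_le ?_
      have h := Relation.TransGen.swap _ _ (transGen_of_ultraClosure_lt hr)
      exact Relation.TransGen.mono (fun k l (hkl : M l k ≤ r) => (hM k l).trans_le hkl) _ _ h
    exact le_antisymm (key j i) (key i j)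
  le_max i j k := by
    refine le_of_forall_gt_imp_ge_of_dense fun r hr => ultraClosure_le ?_
    exact (transGen_of_ultraClosure_lt ((le_max_left _ _).trans_lt hr)).trans
      (transGen_of_ultraClosure_lt ((le_max_right _ _).trans_lt hr))

/-- A chain with links at most `r` for `N` has links at most `r + ε` for `M`. -/
theorem ultraClosure_le_add {ε : ℝ} (h : ∀ i j, M i j ≤ N i j + ε) (i j : ι) :
    ultraClosure M i j ≤ ultraClosure N i j + ε := by
  rw [← sub_le_iff_le_add]
  refine le_of_forall_gt_imp_ge_of_dense fun r hr => ?_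
  rw [sub_le_iff_le_add]
  refine ultraClosure_le (Relation.TransGen.mono (fun k l (hkl : N k l ≤ r) => ?_) _ _
    (transGen_of_ultraClosure_lt hr))
  linarith [h k l]

theorem abs_ultraClosure_sub_le {ε : ℝ} (h : ∀ i j, |M i j - N i j| ≤ ε) (i j : ι) :
    |ultraClosure M i j - ultraClosure N i j| ≤ ε := by
  have h1 := ultraClosure_le_add (fun i j => by linarith [(abs_le.1 (h i j)).2] :
    ∀ i j, M i j ≤ N i j + ε) i j
  have h2 := ultraClosure_le_add (fun i j => by linarith [(abs_le.1 (h i j)).1] :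
    ∀ i j, N i j ≤ M i j + ε) i j
  rw [abs_le]
  constructor <;> linarith

/-- The strong triangle inequality, applied along a chain, bounds `M i j` by its largest link. This
keeps the ends of the interpolation fixed. -/
theorem IsUltraMatrix.ultraClosure_eq (hM : IsUltraMatrix M) : ultraClosure M = M := by
  ext i j
  refine le_antisymm (ultraClosure_le (Relation.TransGen.single le_rfl))
    (le_csInf ⟨M i j, Relation.TransGen.single (show M i j ≤ M i j from le_rfl)⟩ fun r hr => ?_)
  induction hr with
  | single h => exact h
  | tail _ h ih => exact (hM.le_max _ _ _).trans (max_le ih h)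

end ultraClosure

theorem MergeTree.interleavingDist_le {T T' : MergeTree} {ι : Type} [Finite ι] {a : ι → T.Point}
    {b : ι → T'.Point} {U U' : ι → ι → ℝ} (ha : IsLabelling T a U) (hb : IsLabelling T' b U')
    {ε : ℝ} (hε : ∀ i j, |U i j - U' i j| ≤ ε) : interleavingDist T T' ≤ ENNReal.ofReal ε :=
  iInf₂_le ε (ha.exists_isGood hb hε)

/-! ### Lengths of paths and the interpolating path -/

/-- A path all of whose chords are at most `δ` times the parameter difference is continuous. -/
theorem continuousPath_of_le {X : Type*} {d : X → X → ℝ≥0∞} {γ : unitInterval → X} {δ : ℝ}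
    (h : ∀ s t, d (γ s) (γ t) ≤ ENNReal.ofReal (|(s : ℝ) - t| * δ)) : ContinuousPath d γ := by
  intro t
  refine tendsto_of_tendsto_of_tendsto_of_le_of_le tendsto_const_nhds ?_ (fun _ => zero_le)
    (fun s => h t s)
  have hc : Continuous fun s : unitInterval => ENNReal.ofReal (|(t : ℝ) - s| * δ) :=
    ENNReal.continuous_ofReal.comp (by fun_prop)
  simpa using hc.tendsto t

theorem pathLength_le {X : Type*} {d : X → X → ℝ≥0∞} {γ : unitInterval → X} {δ : ℝ} (hδ : 0 ≤ δ)
    (h : ∀ s t, d (γ s) (γ t) ≤ ENNReal.ofReal (|(s : ℝ) - t| * δ)) :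
    pathLength d γ ≤ ENNReal.ofReal δ := by
  refine iSup_le fun n => iSup₂_le fun t ⟨hm, h0, hn⟩ => ?_
  calc ∑ i ∈ Finset.range n, d (γ (t i)) (γ (t (i + 1)))
      ≤ ∑ i ∈ Finset.range n, ENNReal.ofReal (((t (i + 1) : ℝ) - t i) * δ) := by
        refine Finset.sum_le_sum fun i _ => (h _ _).trans_eq ?_
        have : (t i : ℝ) ≤ t (i + 1) := hm i.le_succ
        rw [abs_sub_comm, abs_of_nonneg (sub_nonneg.2 this)]
    _ = ENNReal.ofReal (∑ i ∈ Finset.range n, ((t (i + 1) : ℝ) - t i) * δ) := by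
        refine (ENNReal.ofReal_sum_of_nonneg fun i _ => mul_nonneg (sub_nonneg.2 ?_) hδ).symm
        exact hm i.le_succ
    _ = ENNReal.ofReal δ := by
        rw [← Finset.sum_mul, Finset.sum_range_sub fun i => (t i : ℝ), h0, hn]
        simp

theorem le_pathLength {X : Type*} (d : X → X → ℝ≥0∞) (γ : unitInterval → X) :
    d (γ 0) (γ 1) ≤ pathLength d γ := by
  -- The partition with `n = 1`; the sequence is indexed by all of `ℕ` and stays at 1 after its
  -- first term.
  refine le_iSup_of_le 1 (le_iSup₂_of_le (fun i => if i = 0 then 0 else 1) ⟨?_, by simp⟩ ?_)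
  · intro i j hij
    dsimp only
    split_ifs with hi hj
    · exact le_rfl
    · exact unitInterval.nonneg _
    · omega
    · exact le_rfl
  · simp

/-- The trees of the linear interpolation of the matrices of two labelled trees form a path
between these trees. -/
theorem MergeTree.IsLabelling.exists_path {ι : Type} [Finite ι] [Nonempty ι] {T T' : MergeTree}
    {a : ι → T.Point} {b : ι → T'.Point} {U U' : ι → ι → ℝ} (ha : IsLabelling T a U)
    (hb : IsLabelling T' b U') {δ : ℝ} (hδ : ∀ i j, |U i j - U' i j| ≤ δ) :
    ∃ γ : unitInterval → MergeTree, γ 0 = T ∧ γ 1 = T' ∧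
      ∀ s t, interleavingDist (γ s) (γ t) ≤ ENNReal.ofReal (|(s : ℝ) - t| * δ) := by
  let M : unitInterval → ι → ι → ℝ := fun t i j => U i j + t * (U' i j - U i j)
  have hM0 : M 0 = U := by simp [M]
  have hM1 : M 1 = U' := by simp [M]
  have hsymm : ∀ t i j, M t i j = M t j i := fun t i j => by
    simp only [M, ha.isUltraMatrix.symm i j, hb.isUltraMatrix.symm i j]
  -- At the ends the given trees themselves are taken, so there is no need to show that a matrix
  -- determines its tree up to equivalence.
  have hex : ∀ t, ∃ S : MergeTree, (t = 0 → S = T) ∧ (t = 1 → S = T') ∧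
      ∃ c : ι → S.Point, IsLabelling S c (ultraClosure (M t)) := by
    intro t
    by_cases h0 : t = 0
    · refine ⟨T, fun _ => rfl, fun h1 => absurd (h0.symm.trans h1) zero_ne_one, a, ?_⟩
      rwa [h0, hM0, ha.isUltraMatrix.ultraClosure_eq]
    by_cases h1 : t = 1
    · refine ⟨T', fun h => absurd h h0, fun _ => rfl, b, ?_⟩
      rwa [h1, hM1, hb.isUltraMatrix.ultraClosure_eq]
    · exact ⟨_, fun h => absurd h h0, fun h => absurd h h1, _,
        (isUltraMatrix_ultraClosure (hsymm t)).isLabelling_mergePoint⟩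
  choose γ h0 h1 c hc using hex
  refine ⟨γ, h0 0 rfl, h1 1 rfl, fun s t => interleavingDist_le (hc s) (hc t) ?_⟩
  refine abs_ultraClosure_sub_le fun i j => ?_
  have : M s i j - M t i j = (s - t) * (U' i j - U i j) := by
    simp only [M]
    ring
  rw [this, abs_mul, abs_sub_comm (U' i j)]
  exact mul_le_mul_of_nonneg_left (hδ i j) (abs_nonneg _)

/-- The interleaving distance on the space of finite merge trees coincides with the intrinsic
metric that it induces. -/
theorem mainTheorem1 (T T' : MTSpace) :
    MTSpace.dI T T' = intrinsicDist MTSpace.dI T T' := by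
  refine le_antisymm (le_iInf₂ fun γ ⟨_, h0, h1⟩ => ?_) ?_
  · rw [← h0, ← h1]
    exact le_pathLength _ _
  · induction T, T' using Quotient.inductionOn₂ with
    | _ T T' =>
    refine le_iInf₂ fun δ ⟨α, hα⟩ => ?_
    obtain ⟨ι, _, _, a, b, U, U', ha, hb, hU⟩ := hα.exists_isLabelling
    obtain ⟨γ, h0, h1, hγ⟩ := ha.exists_path hb hU
    have hγ' : ∀ s t, MTSpace.dI (Quotient.mk MergeTree.same (γ s))
        (Quotient.mk MergeTree.same (γ t)) ≤ ENNReal.ofReal (|(s : ℝ) - t| * δ) := hγ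
    exact iInf₂_le_of_le (fun t => Quotient.mk MergeTree.same (γ t))
      ⟨continuousPath_of_le hγ', congrArg _ h0, congrArg _ h1⟩ (pathLength_le hα.nonneg hγ')
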